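/- Let $(f(p))_{p\text{ prime}}$ be independent random variables on a probability space, each taking the values $+1$ and $-1$ with probability $1/2$ each. Extend $f$ to the positive integers by setting $f(n)=\prod_{p\mid n}f(p)$ if $n$ is squarefree (so $f(1)=1$) and $f(n)=0$ otherwise (a Rademacher random multiplicative function), and for real $x$ let $\mathcal M(x)=\sum_{n\le x}f(n)$. Then, almost surely, $\mathcal M(x)$ changes its sign infinitely often as $x\to\infty$; that is, almost surely neither of the two inequalities $\mathcal M(x)\ge 0$ and $\mathcal M(x)\le 0$ holds for all sufficiently large $x$. -/

import Mathlib

open MeasureTheory ProbabilityTheory Filter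

/-- The Rademacher distribution: mass `1/2` at `1` and mass `1/2` at `-1`. -/
noncomputable def rademacherMeasure : Measure ℝ :=
  (2⁻¹ : ENNReal) • Measure.dirac 1 + (2⁻¹ : ENNReal) • Measure.dirac (-1)

/-- `X` is a family, indexed by the primes, of independent Rademacher random variables
on the probability space `(Ω, P)`. -/
structure IsRademacherFamily {Ω : Type*} [MeasurableSpace Ω] (P : Measure Ω)
    (X : Nat.Primes → Ω → ℝ) : Prop where
  measurable : ∀ p, Measurable (X p)
  law : ∀ p, P.map (X p) = rademacherMeasure
  indep : iIndepFun X P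

/-- The extension by multiplicativity of prescribed values at the primes to a function on the
natural numbers that is supported on the squarefree integers. -/
noncomputable def squarefreeExtension (a : Nat.Primes → ℝ) (n : ℕ) : ℝ :=
  if Squarefree n then
    ∏ p ∈ n.primeFactors.attach, a ⟨p.1, Nat.prime_of_mem_primeFactors p.2⟩
  else 0

/-- The Rademacher random multiplicative function with values `X p` at the primes `p`. -/
noncomputable def randomMultiplicative {Ω : Type*} (X : Nat.Primes → Ω → ℝ) (n : ℕ) (ω : Ω) : ℝ :=
  squarefreeExtension (fun p => X p ω) n

/-- The partial sum `∑_{1 ≤ n ≤ x} f n`. -/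
noncomputable def partialSum (f : ℕ → ℝ) (x : ℝ) : ℝ :=
  ∑ n ∈ Finset.Icc 1 ⌊x⌋₊, f n

/-- `M` changes its sign infinitely often as `x → ∞`: neither of the inequalities
`M x ≥ 0` and `M x ≤ 0` holds for all sufficiently large `x`. -/
def ChangesSignInfinitelyOften (M : ℝ → ℝ) : Prop :=
  (¬ ∀ᶠ x in atTop, 0 ≤ M x) ∧ (¬ ∀ᶠ x in atTop, M x ≤ 0)

/-! Suppose that the partial sums M eventually have constant sign. Since F(s) = ∑ f(n) n^(-s) equals
s ∫ M(x) x^(-s-1) dx, an argument in the style of Landau bounds |F(σ + it)| by (|s|/σ)(|F(σ)| +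
O(1)); `norm_abelSum_le` is the finite form. The Euler product contradicts this bound as σ decreases
to 1/2.

For a sign a, log|1 + az| = ½ log|1 - z²| + a · `oddLog z` (`log_norm_one_add_mul`), so log|F| is a
deterministic drift plus a sum of independent terms. On the real axis the drift is at most -V/2 with
V = ∑ p^(-2σ) → ∞, and the random part has standard deviation O(√V), so |F(σ)| ≤ 1 with high
probability. At height t ≠ 0 the drift is -½ log|ζ(2σ + 2it)|, bounded below because ζ is finite at
1 + 2it. For a suitable t the variance of the random part diverges; a fourth-moment bound and the
zero-one law then make this part almost surely unbounded above (`ae_unbounded`).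

Everything is carried out with finite products over p ≤ N_k at points σ_k. These differ from the
Abel sums by a quantity whose second moment, `truncationError`, tends to 0 as N → ∞ for fixed σ >
1/2. Chebyshev and Borel–Cantelli discard the exceptional events. -/

open Topology

/-! ### Squarefree integers as products of finite sets of primes -/

/-- The inclusion of the primes into the natural numbers. -/
def primeEmbedding : Nat.Primes ↪ ℕ := ⟨fun p => (p : ℕ), Nat.Primes.coe_nat_injective⟩

/-- The primes up to `N`, as a finite set of `Nat.Primes`. -/
noncomputable def primesUpTo (N : ℕ) : Finset Nat.Primes :=
  (Nat.primesLE N).preimage primeEmbedding primeEmbedding.injective.injOn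

/-- The product of a finite set of primes. -/
def primeProd (S : Finset Nat.Primes) : ℕ := ∏ p ∈ S, (p : ℕ)

lemma mem_primesUpTo {N : ℕ} {p : Nat.Primes} : p ∈ primesUpTo N ↔ (p : ℕ) ≤ N := by
  rw [primesUpTo, Finset.mem_preimage, Nat.mem_primesLE]
  exact ⟨fun h => h.1, fun h => ⟨h, p.2⟩⟩

lemma primesUpTo_mono : Monotone primesUpTo := fun _ _ h _ hp =>
  mem_primesUpTo.2 ((mem_primesUpTo.1 hp).trans h)

lemma tendsto_primesUpTo_atTop : Tendsto primesUpTo atTop atTop :=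
  tendsto_atTop_finset_of_monotone primesUpTo_mono fun p => ⟨p, mem_primesUpTo.2 le_rfl⟩

lemma primeProd_eq_prod_map (S : Finset Nat.Primes) :
    primeProd S = ∏ q ∈ S.map primeEmbedding, q := by
  rw [Finset.prod_map]; rfl

lemma primeFactors_primeProd (S : Finset Nat.Primes) :
    (primeProd S).primeFactors = S.map primeEmbedding := by
  rw [primeProd_eq_prod_map]
  apply Nat.primeFactors_prod
  intro p hp
  obtain ⟨q, -, rfl⟩ := Finset.mem_map.1 hp
  exact q.2

lemma primeProd_injective : Function.Injective primeProd := by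
  intro S T h
  have := congrArg Nat.primeFactors h
  rw [primeFactors_primeProd, primeFactors_primeProd] at this
  exact Finset.map_injective _ this

lemma primeProd_pos (S : Finset Nat.Primes) : 0 < primeProd S :=
  Finset.prod_pos fun p _ => p.2.pos

lemma squarefree_primeProd (S : Finset Nat.Primes) : Squarefree (primeProd S) := by
  induction S using Finset.induction_on with
  | empty => simp [primeProd]
  | insert p S hp ih =>
    have : primeProd (insert p S) = p * primeProd S := Finset.prod_insert hp
    rw [this, Nat.squarefree_mul_iff]
    refine ⟨?_, p.2.squarefree, ih⟩
    refine Nat.Coprime.prod_right fun q hq => (Nat.coprime_primes p.2 q.2).2 fun h => ?_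
    exact hp (by rwa [Subtype.ext h])

lemma squarefreeExtension_primeProd (a : Nat.Primes → ℝ) (S : Finset Nat.Primes) :
    squarefreeExtension a (primeProd S) = ∏ p ∈ S, a p := by
  rw [squarefreeExtension, if_pos (squarefree_primeProd S)]
  refine Finset.prod_bij (fun p _ => ⟨p.1, Nat.prime_of_mem_primeFactors p.2⟩) ?_ ?_ ?_ ?_
  · rintro ⟨p, hp⟩ -
    rw [primeFactors_primeProd] at hp
    obtain ⟨q, hq, rfl⟩ := Finset.mem_map.1 hp
    exact hq
  · rintro ⟨p, hp⟩ - ⟨q, hq⟩ - h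
    exact Subtype.ext (congrArg (fun r : Nat.Primes => (r : ℕ)) h)
  · intro q hq
    exact ⟨⟨q, by rw [primeFactors_primeProd]; exact Finset.mem_map_of_mem _ hq⟩, by simp, rfl⟩
  · simp

lemma exists_primeProd_eq {n : ℕ} (hn : Squarefree n) : ∃ S ⊆ primesUpTo n, primeProd S = n := by
  refine ⟨n.primeFactors.preimage primeEmbedding primeEmbedding.injective.injOn, fun p hp => ?_, ?_⟩
  · rw [Finset.mem_preimage] at hp
    exact mem_primesUpTo.2 (Nat.le_of_mem_primeFactors hp)
  · refine (Finset.prod_preimage primeEmbedding _ _ (fun q => q) ?_).trans ?_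
    · exact fun q hq h => (h ⟨⟨q, Nat.prime_of_mem_primeFactors hq⟩, rfl⟩).elim
    · exact Nat.prod_primeFactors_of_squarefree hn

/-- Indexing by sets of primes exposes the orthogonality of the products ∏ a p. The weight `g` is
arbitrary because both n^(-s) and the constant boundary weight (N + 1)^(-s) are needed. -/
lemma sum_squarefreeExtension_mul (a : Nat.Primes → ℝ) (g : ℕ → ℂ) (N : ℕ) :
    ∑ n ∈ Finset.Icc 1 N, (squarefreeExtension a n : ℂ) * g n =
      ∑ S ∈ (primesUpTo N).powerset with primeProd S ≤ N,
        ((∏ p ∈ S, a p : ℝ) : ℂ) * g (primeProd S) := by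
  symm
  refine Finset.sum_of_injOn primeProd primeProd_injective.injOn ?_ ?_ ?_
  · intro S hS
    simp only [Finset.coe_filter, Set.mem_ofPred_eq] at hS
    simpa using ⟨primeProd_pos S, hS.2⟩
  · intro n hn hn'
    have : ¬ Squarefree n := by
      intro h
      obtain ⟨S, hS, rfl⟩ := exists_primeProd_eq h
      refine hn' ⟨S, ?_, rfl⟩
      have h1 := (Finset.mem_Icc.1 hn).2
      simpa using ⟨hS.trans (primesUpTo_mono h1), h1⟩
    simp [squarefreeExtension, this]
  · intro S _
    rw [squarefreeExtension_primeProd]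

lemma natCast_primeProd_cpow (S : Finset Nat.Primes) (s : ℂ) :
    (primeProd S : ℂ) ^ s = ∏ p ∈ S, ((p : ℕ) : ℂ) ^ s := by
  induction S using Finset.induction_on with
  | empty => simp [primeProd]
  | insert p S hp ih =>
    have : primeProd (insert p S) = p * primeProd S := Finset.prod_insert hp
    rw [this, Finset.prod_insert hp, ← ih, Nat.cast_mul, Complex.natCast_mul_natCast_cpow]

lemma prod_one_add_mul_cpow (a : Nat.Primes → ℝ) (P : Finset Nat.Primes) (s : ℂ) :
    ∏ p ∈ P, (1 + (a p : ℂ) * ((p : ℕ) : ℂ) ^ s) =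
      ∑ S ∈ P.powerset, ((∏ p ∈ S, a p : ℝ) : ℂ) * (primeProd S : ℂ) ^ s := by
  rw [Finset.prod_one_add]
  refine Finset.sum_congr rfl fun S _ => ?_
  rw [Finset.prod_mul_distrib, natCast_primeProd_cpow, Complex.ofReal_prod]

/-! ### Abel summation and the effect of a constant sign -/

/-- The sum obtained from `∑ n ≤ N, f n / n ^ s` by Abel summation. -/
noncomputable def abelSum (f : ℕ → ℝ) (N : ℕ) (s : ℂ) : ℂ :=
  ∑ n ∈ Finset.Icc 1 N, (partialSum f n : ℂ) * ((n : ℂ) ^ (-s) - ((n : ℂ) + 1) ^ (-s))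

lemma partialSum_natCast (f : ℕ → ℝ) (N : ℕ) : partialSum f N = ∑ n ∈ Finset.Icc 1 N, f n := by
  simp [partialSum]

lemma sum_mul_cpow_eq_abelSum (f : ℕ → ℝ) (N : ℕ) (s : ℂ) :
    ∑ n ∈ Finset.Icc 1 N, (f n : ℂ) * (n : ℂ) ^ (-s) =
      (partialSum f N : ℂ) * ((N : ℂ) + 1) ^ (-s) + abelSum f N s := by
  induction N with
  | zero => simp [abelSum, partialSum]
  | succ N ih =>
    have h : abelSum f (N + 1) s = abelSum f N s + (partialSum f (N + 1 : ℕ) : ℂ) *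
        (((N + 1 : ℕ) : ℂ) ^ (-s) - (((N + 1 : ℕ) : ℂ) + 1) ^ (-s)) := by
      rw [abelSum, Finset.sum_Icc_succ_top (by lia)]; rfl
    have h' : partialSum f (N + 1 : ℕ) = partialSum f N + f (N + 1) := by
      rw [partialSum_natCast, partialSum_natCast, Finset.sum_Icc_succ_top (by lia)]
    rw [Finset.sum_Icc_succ_top (by lia), ih, h, h']
    push_cast
    ring

/-- The difference of the finite Euler product and the Abel-summed Dirichlet polynomial is
a combination of the products of the `a p` with small coefficients. -/
lemma prod_sub_abelSum (a : Nat.Primes → ℝ) (N : ℕ) (s : ℂ) :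
    ∏ p ∈ primesUpTo N, (1 + (a p : ℂ) * ((p : ℕ) : ℂ) ^ (-s)) -
        abelSum (squarefreeExtension a) N s =
      ∑ S ∈ (primesUpTo N).powerset,
        ((∏ p ∈ S, a p : ℝ) : ℂ) * ((max (primeProd S) (N + 1) : ℕ) : ℂ) ^ (-s) := by
  have h1 := sum_mul_cpow_eq_abelSum (squarefreeExtension a) N s
  have h2 := sum_squarefreeExtension_mul a (fun n => (n : ℂ) ^ (-s)) N
  have h3 := sum_squarefreeExtension_mul a (fun _ => ((N : ℂ) + 1) ^ (-s)) N
  rw [← Finset.sum_mul] at h3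
  have h4 : abelSum (squarefreeExtension a) N s =
      ∑ S ∈ (primesUpTo N).powerset with primeProd S ≤ N,
        ((∏ p ∈ S, a p : ℝ) : ℂ) * ((primeProd S : ℂ) ^ (-s) - ((N : ℂ) + 1) ^ (-s)) := by
    simp_rw [mul_sub, Finset.sum_sub_distrib]
    rw [← h2, ← h3, h1, partialSum_natCast]
    push_cast
    ring
  rw [h4, prod_one_add_mul_cpow, Finset.sum_filter, ← Finset.sum_sub_distrib]
  refine Finset.sum_congr rfl fun S _ => ?_
  -- For products at most N, the main terms cancel and only the boundary weight (N + 1)^(-s) of Abel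
  -- summation survives; larger products are absent from the Abel sum.
  split_ifs with h
  · rw [max_eq_right (by lia)]; push_cast; ring
  · rw [max_eq_left (by lia)]; ring

/-- Both differences are integrals over [n, n + 1], of s x^(-s-1) and of Re(s) x^(-Re(s)-1), and the
second integrand is the norm of the first up to the factor |s|/Re(s). -/
lemma norm_cpow_sub_cpow_le {s : ℂ} (hs : 0 < s.re) {n : ℕ} (hn : 1 ≤ n) :
    ‖(n : ℂ) ^ (-s) - ((n : ℂ) + 1) ^ (-s)‖ ≤
      ‖s‖ / s.re * ((n : ℝ) ^ (-s.re) - ((n : ℝ) + 1) ^ (-s.re)) := by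
  have hn0 : (0 : ℝ) < n := by exact_mod_cast hn
  have hs0 : s ≠ 0 := by rintro rfl; simp at hs
  have h0 : (0 : ℝ) ∉ Set.uIcc (n : ℝ) (n + 1) := by
    rw [Set.uIcc_of_le (by linarith)]; intro h; linarith [h.1]
  have h1 : ∫ x : ℝ in (n : ℝ)..(n + 1), (x : ℂ) ^ (-s - 1) =
      ((n : ℂ) ^ (-s) - ((n : ℂ) + 1) ^ (-s)) / s := by
    rw [integral_cpow (Or.inr ⟨by intro h; apply hs0; linear_combination -h, h0⟩)]
    simp only [sub_add_cancel, Complex.ofReal_add, Complex.ofReal_natCast, Complex.ofReal_one]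
    rw [div_neg, ← neg_div, neg_sub]
  have h2 : ∫ x : ℝ in (n : ℝ)..(n + 1), x ^ (-s.re - 1) =
      ((n : ℝ) ^ (-s.re) - ((n : ℝ) + 1) ^ (-s.re)) / s.re := by
    rw [integral_rpow (Or.inr ⟨by intro h; linarith, h0⟩)]
    simp only [sub_add_cancel]
    rw [div_neg, ← neg_div, neg_sub]
  have h3 : ‖∫ x : ℝ in (n : ℝ)..(n + 1), (x : ℂ) ^ (-s - 1)‖ ≤
      ∫ x : ℝ in (n : ℝ)..(n + 1), x ^ (-s.re - 1) := by
    refine (intervalIntegral.norm_integral_le_integral_norm (by linarith)).trans_eq ?_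
    refine intervalIntegral.integral_congr fun x hx => ?_
    rw [Set.uIcc_of_le (by linarith)] at hx
    simp [Complex.norm_cpow_eq_rpow_re_of_pos (hn0.trans_le hx.1)]
  rw [h1, h2, norm_div, div_le_iff₀ (norm_pos_iff.2 hs0)] at h3
  exact h3.trans_eq (by ring)

/-- With a constant sign from `n₀` on, absolute values can be taken outside the sum; each earlier
index costs at most 2|u n|. -/
lemma sum_abs_mul_le {u d : ℕ → ℝ} {n₀ : ℕ} (hu : (∀ n ≥ n₀, 0 ≤ u n) ∨ (∀ n ≥ n₀, u n ≤ 0))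
    (A : Finset ℕ) (hd0 : ∀ n ∈ A, 0 ≤ d n) (hd1 : ∀ n ∈ A, d n ≤ 1) :
    ∑ n ∈ A, |u n| * d n ≤ |∑ n ∈ A, u n * d n| + 2 * ∑ n ∈ Finset.range n₀, |u n| := by
  wlog h : ∀ n ≥ n₀, 0 ≤ u n generalizing u
  · have h' := hu.resolve_left h
    have := this (u := fun n => - u n) (Or.inl fun n hn => by simpa using h' n hn)
      (fun n hn => by simpa using h' n hn)
    simpa [abs_neg] using this
  have h1 : ∑ n ∈ A, (|u n| - u n) * d n ≤ 2 * ∑ n ∈ Finset.range n₀, |u n| := by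
    rw [Finset.mul_sum]
    calc ∑ n ∈ A, (|u n| - u n) * d n
        ≤ ∑ n ∈ A, if n < n₀ then 2 * |u n| else 0 := by
          refine Finset.sum_le_sum fun n hn => ?_
          split_ifs with hlt
          · have h2 := neg_abs_le (u n)
            have h3 := le_abs_self (u n)
            nlinarith [hd0 n hn, hd1 n hn]
          · rw [abs_of_nonneg (h n (by lia))]; simp
      _ = ∑ n ∈ A with n < n₀, 2 * |u n| := by rw [Finset.sum_filter]
      _ ≤ _ := Finset.sum_le_sum_of_subset_of_nonneg (fun n hn => by simp at hn ⊢; exact hn.2)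
          fun _ _ _ => by positivity
  have h2 : ∑ n ∈ A, |u n| * d n = ∑ n ∈ A, u n * d n + ∑ n ∈ A, (|u n| - u n) * d n := by
    rw [← Finset.sum_add_distrib]; exact Finset.sum_congr rfl fun _ _ => by ring
  linarith [le_abs_self (∑ n ∈ A, u n * d n)]

/-- If the partial sums are eventually of constant sign, then `abelSum` at `s` is controlled
by its value at the real part of `s`. -/
lemma norm_abelSum_le {f : ℕ → ℝ} {n₀ : ℕ}
    (hf : (∀ n : ℕ, n ≥ n₀ → 0 ≤ partialSum f n) ∨ (∀ n : ℕ, n ≥ n₀ → partialSum f n ≤ 0))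
    (N : ℕ) {s : ℂ} (hs : 0 < s.re) :
    ‖abelSum f N s‖ ≤ ‖s‖ / s.re *
      (‖abelSum f N s.re‖ + 2 * ∑ n ∈ Finset.range n₀, |partialSum f n|) := by
  set d : ℕ → ℝ := fun n => (n : ℝ) ^ (-s.re) - ((n : ℝ) + 1) ^ (-s.re) with hd
  have hreal : abelSum f N s.re = ((∑ n ∈ Finset.Icc 1 N, partialSum f n * d n : ℝ) : ℂ) := by
    rw [abelSum, Complex.ofReal_sum]
    refine Finset.sum_congr rfl fun n _ => ?_
    rw [hd, Complex.ofReal_mul, Complex.ofReal_sub, Complex.ofReal_cpow (by positivity),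
      Complex.ofReal_cpow (by positivity)]
    simp
  have h1 : ‖abelSum f N s‖ ≤ ‖s‖ / s.re * ∑ n ∈ Finset.Icc 1 N, |partialSum f n| * d n := by
    rw [Finset.mul_sum]
    refine norm_sum_le_of_le _ fun n hn => ?_
    rw [norm_mul, Complex.norm_real, Real.norm_eq_abs]
    calc |partialSum f n| * _ ≤ |partialSum f n| * (‖s‖ / s.re * d n) := by
          gcongr; exact norm_cpow_sub_cpow_le hs (Finset.mem_Icc.1 hn).1
      _ = _ := by ring
  refine h1.trans ?_
  gcongr
  rw [hreal, Complex.norm_real, Real.norm_eq_abs]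
  refine sum_abs_mul_le (u := fun n => partialSum f n) hf _ (fun n hn => ?_) fun n hn => ?_
  · have hn1 : (0 : ℝ) < n := by exact_mod_cast (Finset.mem_Icc.1 hn).1
    have := Real.rpow_le_rpow_of_nonpos hn1 (by linarith : (n : ℝ) ≤ n + 1)
      (by linarith : -s.re ≤ 0)
    simp only [hd]; linarith
  · have hn1 : (1 : ℝ) ≤ n := by exact_mod_cast (Finset.mem_Icc.1 hn).1
    have h2 := Real.rpow_le_one_of_one_le_of_nonpos hn1 (by linarith : -s.re ≤ 0)
    have h3 : 0 ≤ ((n : ℝ) + 1) ^ (-s.re) := by positivity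
    simp only [hd]; linarith

/-! ### Even and odd parts of the logarithm of an Euler factor -/

/-- The odd part of `z ↦ log ‖1 + z‖`, that is, the real part of `artanh z`. -/
noncomputable def oddLog (z : ℂ) : ℝ := (Real.log ‖1 + z‖ - Real.log ‖1 - z‖) / 2

lemma abs_log_norm_one_add_sub_re_le {z : ℂ} (hz : ‖z‖ ^ 2 ≤ 1 / 2) :
    |Real.log ‖1 + z‖ - z.re| ≤ 2 * ‖z‖ ^ 2 := by
  have h1 : ‖z‖ ≤ 3 / 4 := by nlinarith [norm_nonneg z]
  have h2 := Complex.norm_log_one_add_sub_self_le (z := z) (by linarith)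
  -- The Taylor remainder is at most ‖z‖² (1 - ‖z‖)⁻¹ / 2, which gives the constant 2.
  have h3 : (1 - ‖z‖)⁻¹ ≤ 4 := by
    rw [inv_le_comm₀ (by linarith) (by norm_num)]; linarith
  rw [← Complex.log_re, ← Complex.sub_re]
  refine (Complex.abs_re_le_norm _).trans (h2.trans ?_)
  nlinarith [sq_nonneg ‖z‖]

lemma abs_oddLog_sub_re_le {z : ℂ} (hz : ‖z‖ ^ 2 ≤ 1 / 2) : |oddLog z - z.re| ≤ 2 * ‖z‖ ^ 2 := by
  have h1 := abs_le.1 (abs_log_norm_one_add_sub_re_le hz)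
  have h2 := abs_le.1 (abs_log_norm_one_add_sub_re_le (z := -z) (by rwa [norm_neg]))
  rw [norm_neg, Complex.neg_re, ← sub_eq_add_neg] at h2
  rw [abs_le, oddLog]
  constructor <;> linarith

lemma abs_oddLog_le {z : ℂ} (hz : ‖z‖ ^ 2 ≤ 1 / 2) : |oddLog z| ≤ 3 * ‖z‖ := by
  have h1 : ‖z‖ ≤ 3 / 4 := by nlinarith [norm_nonneg z]
  have h2 := abs_le.1 (abs_oddLog_sub_re_le hz)
  have h3 := abs_le.1 (Complex.abs_re_le_norm z)
  rw [abs_le]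
  constructor <;> nlinarith [norm_nonneg z]

lemma one_add_ne_zero_of_norm_sq_le {z : ℂ} (hz : ‖z‖ ^ 2 ≤ 1 / 2) : 1 + z ≠ 0 := by
  intro h
  rw [add_eq_zero_iff_neg_eq] at h
  rw [← h] at hz
  norm_num at hz

lemma one_sub_ne_zero_of_norm_sq_le {z : ℂ} (hz : ‖z‖ ^ 2 ≤ 1 / 2) : 1 - z ≠ 0 := by
  rw [sub_eq_add_neg]
  exact one_add_ne_zero_of_norm_sq_le (by rwa [norm_neg])

/-- The even part of log|1 + z| is ½ log|(1 + z)(1 - z)| and ignores the sign; the odd part is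
multiplied by it. -/
lemma log_norm_one_add_mul {a : ℝ} (ha : a = 1 ∨ a = -1) {z : ℂ} (hz : ‖z‖ ^ 2 ≤ 1 / 2) :
    Real.log ‖1 + a * z‖ = Real.log ‖1 - z ^ 2‖ / 2 + a * oddLog z := by
  have h1 := norm_ne_zero_iff.2 (one_add_ne_zero_of_norm_sq_le hz)
  have h2 := norm_ne_zero_iff.2 (one_sub_ne_zero_of_norm_sq_le hz)
  have h3 : (1 : ℂ) - z ^ 2 = (1 + z) * (1 - z) := by ring
  rw [h3, norm_mul, Real.log_mul h1 h2, oddLog]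
  rcases ha with rfl | rfl
  · simp; ring
  · have : (1 : ℂ) + ((-1 : ℝ) : ℂ) * z = 1 - z := by push_cast; ring
    rw [this]; ring

lemma prod_norm_one_add_mul {ι : Type*} (A : Finset ι) {a : ι → ℝ} (ha : ∀ i, a i = 1 ∨ a i = -1)
    {z : ι → ℂ} (hz : ∀ i, ‖z i‖ ^ 2 ≤ 1 / 2) :
    ‖∏ i ∈ A, (1 + (a i : ℂ) * z i)‖ =
      Real.sqrt (∏ i ∈ A, ‖1 - z i ^ 2‖) * Real.exp (∑ i ∈ A, a i * oddLog (z i)) := by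
  have hpos : ∀ i, 0 < ‖1 - z i ^ 2‖ := fun i => by
    have h3 : (1 : ℂ) - z i ^ 2 = (1 + z i) * (1 - z i) := by ring
    rw [h3]
    exact norm_pos_iff.2 (mul_ne_zero (one_add_ne_zero_of_norm_sq_le (hz i))
      (one_sub_ne_zero_of_norm_sq_le (hz i)))
  have hpos' : ∀ i, 0 < ‖1 + (a i : ℂ) * z i‖ := fun i => by
    refine norm_pos_iff.2 (one_add_ne_zero_of_norm_sq_le ?_)
    rcases ha i with h | h <;> simpa [h] using hz i
  rw [norm_prod, ← Real.exp_log (Finset.prod_pos fun i _ => hpos' i),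
    ← Real.exp_log (Real.sqrt_pos.2 (Finset.prod_pos fun i _ => hpos i)), ← Real.exp_add,
    Real.log_sqrt (Finset.prod_nonneg fun i _ => norm_nonneg _),
    Real.log_prod (fun i _ => (hpos' i).ne'), Real.log_prod (fun i _ => (hpos i).ne'),
    Finset.sum_div, ← Finset.sum_add_distrib]
  exact congrArg _ (Finset.sum_congr rfl fun i _ => log_norm_one_add_mul (ha i) (hz i))

/-! ### Divergence over the primes and choice of parameters -/

lemma norm_prime_cpow (p : Nat.Primes) (s : ℂ) :
    ‖((p : ℕ) : ℂ) ^ (-s)‖ = ((p : ℕ) : ℝ) ^ (-s.re) := by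
  rw [Complex.norm_natCast_cpow_of_pos p.2.pos, Complex.neg_re]

lemma norm_prime_cpow_sq (p : Nat.Primes) (s : ℂ) :
    ‖((p : ℕ) : ℂ) ^ (-s)‖ ^ 2 = ((p : ℕ) : ℝ) ^ (-(2 * s.re)) := by
  rw [norm_prime_cpow, ← Real.rpow_natCast, ← Real.rpow_mul (by positivity)]
  congr 1; push_cast; ring

lemma norm_prime_cpow_sq_le (p : Nat.Primes) {s : ℂ} (hs : 1 / 2 ≤ s.re) :
    ‖((p : ℕ) : ℂ) ^ (-s)‖ ^ 2 ≤ 1 / 2 := by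
  have hp : (2 : ℝ) ≤ (p : ℕ) := by exact_mod_cast p.2.two_le
  rw [norm_prime_cpow_sq]
  calc ((p : ℕ) : ℝ) ^ (-(2 * s.re)) ≤ ((p : ℕ) : ℝ) ^ (-1 : ℝ) :=
        Real.rpow_le_rpow_of_exponent_le (by linarith) (by linarith)
    _ ≤ 1 / 2 := by
        rw [Real.rpow_neg_one, one_div]; gcongr

lemma abs_oddLog_prime_cpow_le (p : Nat.Primes) {s : ℂ} (hs : 1 / 2 ≤ s.re) :
    |oddLog (((p : ℕ) : ℂ) ^ (-s))| ≤ 3 := by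
  have h1 := norm_prime_cpow_sq_le p hs
  have h2 := abs_oddLog_le h1
  nlinarith [norm_nonneg (((p : ℕ) : ℂ) ^ (-s))]

/-- Partial sums over primes of nonnegative continuous functions become large near a point of
divergence. -/
lemma eventually_le_sum_primesUpTo {g : Nat.Primes → ℝ → ℝ} {x : ℝ} (hg : ∀ p y, 0 ≤ g p y)
    (hc : ∀ p, ContinuousAt (g p) x) (hx : ¬ Summable fun p => g p x) (K : ℝ) :
    ∀ᶠ y in 𝓝 x, ∀ᶠ N in atTop, K ≤ ∑ p ∈ primesUpTo N, g p y := by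
  obtain ⟨A, hA⟩ : ∃ A : Finset Nat.Primes, K < ∑ p ∈ A, g p x := by
    by_contra! h
    exact hx (summable_of_sum_le (fun p => hg p x) h)
  obtain ⟨M, hAM⟩ := (tendsto_primesUpTo_atTop.eventually_ge_atTop A).exists
  -- One finite sum already exceeds K at x. It still does so nearby by continuity, and adding
  -- further nonnegative terms preserves this.
  have hM := hA.trans_le (Finset.sum_le_sum_of_subset_of_nonneg hAM fun p _ _ => hg p x)
  have h2 : ContinuousAt (fun y => ∑ p ∈ primesUpTo M, g p y) x :=
    tendsto_finsetSum _ fun p _ => hc p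
  filter_upwards [h2.eventually_const_lt hM] with y hy
  filter_upwards [eventually_ge_atTop M] with N hN
  exact hy.le.trans (Finset.sum_le_sum_of_subset_of_nonneg (primesUpTo_mono hN) fun p _ _ => hg p y)

lemma eventually_le_sum_rpow (K : ℝ) :
    ∀ᶠ σ : ℝ in 𝓝 (1 / 2 : ℝ), ∀ᶠ N in atTop,
      K ≤ ∑ p ∈ primesUpTo N, ((p : ℕ) : ℝ) ^ (-(2 * σ)) := by
  refine eventually_le_sum_primesUpTo (g := fun p σ => ((p : ℕ) : ℝ) ^ (-(2 * σ)))
    (fun p y => by positivity) (fun p => ?_) ?_ K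
  · have : ((p : ℕ) : ℝ) ≠ 0 := by exact_mod_cast p.2.ne_zero
    exact ContinuousAt.rpow continuousAt_const (by fun_prop) (Or.inl this)
  · rw [show -(2 * (1 / 2 : ℝ)) = -1 by norm_num, Nat.Primes.summable_rpow]
    norm_num

lemma eventually_le_sum_oddLog_sq {t : ℝ}
    (ht : ¬ Summable fun p : Nat.Primes =>
      oddLog (((p : ℕ) : ℂ) ^ (-(((1 / 2 : ℝ) : ℂ) + t * Complex.I))) ^ 2) (K : ℝ) :
    ∀ᶠ σ : ℝ in 𝓝 (1 / 2 : ℝ), ∀ᶠ N in atTop,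
      K ≤ ∑ p ∈ primesUpTo N, oddLog (((p : ℕ) : ℂ) ^ (-((σ : ℂ) + t * Complex.I))) ^ 2 := by
  refine eventually_le_sum_primesUpTo
    (g := fun p σ => oddLog (((p : ℕ) : ℂ) ^ (-((σ : ℂ) + t * Complex.I))) ^ 2)
    (fun p y => by positivity) (fun p => ?_) ht K
  have hp : ((p : ℕ) : ℂ) ≠ 0 := by exact_mod_cast p.2.ne_zero
  have hz : ContinuousAt (fun σ : ℝ => ((p : ℕ) : ℂ) ^ (-((σ : ℂ) + t * Complex.I))) (1 / 2) :=
    ContinuousAt.const_cpow (by fun_prop) (Or.inl hp)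
  have hb := norm_prime_cpow_sq_le p (s := ((1 / 2 : ℝ) : ℂ) + t * Complex.I) (by simp)
  refine ContinuousAt.pow (ContinuousAt.div_const (ContinuousAt.sub ?_ ?_) 2) 2
  · exact ((continuousAt_const.add hz).norm).log
      (norm_ne_zero_iff.2 (one_add_ne_zero_of_norm_sq_le hb))
  · exact ((continuousAt_const.sub hz).norm).log
      (norm_ne_zero_iff.2 (one_sub_ne_zero_of_norm_sq_le hb))

lemma prime_cpow_re (p : Nat.Primes) (t : ℝ) :
    (((p : ℕ) : ℂ) ^ (-(((1 / 2 : ℝ) : ℂ) + t * Complex.I))).re ^ 2 =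
      Real.cos (t * Real.log (p : ℕ)) ^ 2 * ((p : ℕ) : ℝ) ^ (-1 : ℝ) := by
  have hp : (0 : ℝ) < (p : ℕ) := by exact_mod_cast p.2.pos
  have h : ((p : ℕ) : ℂ) ^ (-(((1 / 2 : ℝ) : ℂ) + t * Complex.I)) =
      ((((p : ℕ) : ℝ) ^ (-(1 / 2) : ℝ) : ℝ) : ℂ) *
        Complex.exp ((-(t * Real.log (p : ℕ)) : ℝ) * Complex.I) := by
    rw [neg_add, Complex.cpow_add _ _ (by exact_mod_cast p.2.ne_zero),
      Complex.ofReal_cpow hp.le, Complex.cpow_def_of_ne_zero (x := ((p : ℕ) : ℂ))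
      (y := -(t * Complex.I)) (by exact_mod_cast p.2.ne_zero), ← Complex.natCast_log]
    push_cast
    ring_nf
  rw [h, Complex.re_ofReal_mul, Complex.exp_ofReal_mul_I_re, Real.cos_neg, mul_pow, mul_comm,
    ← Real.rpow_natCast (_ ^ _), ← Real.rpow_mul hp.le]
  norm_num

/-- One of t = 1, 2 works: otherwise ∑ cos²(t log p)/p converges for both, and since cos²θ + cos²2θ
is bounded below, so does ∑ 1/p. -/
lemma exists_not_summable_oddLog_sq : ∃ t : ℝ, t ≠ 0 ∧ ¬ Summable fun p : Nat.Primes =>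
      oddLog (((p : ℕ) : ℂ) ^ (-(((1 / 2 : ℝ) : ℂ) + t * Complex.I))) ^ 2 := by
  by_contra! hcon
  have key : ∀ t : ℝ, t ≠ 0 → Summable fun p : Nat.Primes =>
      Real.cos (t * Real.log (p : ℕ)) ^ 2 * ((p : ℕ) : ℝ) ^ (-1 : ℝ) := by
    intro t ht
    have h2 : Summable fun p : Nat.Primes => ((p : ℕ) : ℝ) ^ (-2 : ℝ) :=
      Nat.Primes.summable_rpow.2 (by norm_num)
    -- With |x - y| ≤ 2/p, the bound y² ≤ 2x² + 2(x - y)² gives 2x² + 8/p².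
    refine Summable.of_nonneg_of_le (fun p => by positivity) (fun p => ?_)
      (((hcon t ht).mul_left 2).add (h2.mul_left 8))
    rw [← prime_cpow_re]
    set s : ℂ := ((1 / 2 : ℝ) : ℂ) + t * Complex.I with hs
    have hre : s.re = 1 / 2 := by simp [hs]
    have hb := abs_oddLog_sub_re_le (norm_prime_cpow_sq_le p (s := s) hre.ge)
    rw [norm_prime_cpow_sq, hre] at hb
    have h4 : (((p : ℕ) : ℝ) ^ (-(2 * (1 / 2)) : ℝ)) ^ 2 = ((p : ℕ) : ℝ) ^ (-2 : ℝ) := by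
      rw [← Real.rpow_natCast, ← Real.rpow_mul (by positivity)]; norm_num
    rw [← h4]
    set x := oddLog (((p : ℕ) : ℂ) ^ (-s))
    set y := (((p : ℕ) : ℂ) ^ (-s)).re
    have h5 := sq_le_sq' (abs_le.1 hb).1 (abs_le.1 hb).2
    nlinarith [sq_nonneg (2 * x - y)]
  have h := (key 1 one_ne_zero).add (key 2 two_ne_zero)
  have h' : Summable fun p : Nat.Primes => ((p : ℕ) : ℝ) ^ (-1 : ℝ) := by
    refine Summable.of_nonneg_of_le (fun p => by positivity) (fun p => ?_) (h.mul_left (16 / 7))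
    rw [Real.cos_two_mul, one_mul]
    have hp : 0 ≤ ((p : ℕ) : ℝ) ^ (-1 : ℝ) := by positivity
    set u := Real.cos (Real.log (p : ℕ))
    -- u² + (2u² - 1)² = 7/16 + (8u² - 3)²/16.
    have : 1 ≤ 16 / 7 * (u ^ 2 + (2 * u ^ 2 - 1) ^ 2) := by nlinarith [sq_nonneg (8 * u ^ 2 - 3)]
    calc ((p : ℕ) : ℝ) ^ (-1 : ℝ) = 1 * ((p : ℕ) : ℝ) ^ (-1 : ℝ) := (one_mul _).symm
      _ ≤ 16 / 7 * (u ^ 2 + (2 * u ^ 2 - 1) ^ 2) * ((p : ℕ) : ℝ) ^ (-1 : ℝ) := by gcongr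
      _ = _ := by ring
  rw [Nat.Primes.summable_rpow] at h'
  norm_num at h'

/-- For σ > 1/2 the products converge to 1/|ζ(2σ + 2it)|, and ζ is continuous at 1 + 2it because t ≠
0. -/
lemma exists_le_prod_norm_one_sub {t : ℝ} (ht : t ≠ 0) : ∃ c > 0, ∀ᶠ σ : ℝ in 𝓝[>] (1 / 2 : ℝ),
    ∀ᶠ N in atTop,
      c ≤ ∏ p ∈ primesUpTo N, ‖1 - (((p : ℕ) : ℂ) ^ (-((σ : ℂ) + t * Complex.I))) ^ 2‖ := by
  have hne : (2 : ℂ) * (((1 / 2 : ℝ) : ℂ) + t * Complex.I) ≠ 1 := by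
    intro h
    have := congrArg Complex.im h
    simp at this
    exact ht this
  have hcont : ContinuousAt
      (fun σ : ℝ => ‖riemannZeta (2 * ((σ : ℂ) + t * Complex.I))‖) (1 / 2) := by
    refine ContinuousAt.norm ?_
    refine ContinuousAt.comp (f := fun σ : ℝ => 2 * ((σ : ℂ) + t * Complex.I))
      (differentiableAt_riemannZeta hne).continuousAt (by fun_prop)
  set B := ‖riemannZeta (2 * (((1 / 2 : ℝ) : ℂ) + t * Complex.I))‖ + 1 with hB
  have hB0 : 0 < B := by positivity
  refine ⟨B⁻¹, by positivity, ?_⟩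
  have h1 := hcont.eventually_lt_const (show _ < B by rw [hB]; exact lt_add_one _)
  filter_upwards [h1.filter_mono nhdsWithin_le_nhds, self_mem_nhdsWithin] with σ hσ hσ2
  have hσ3 : (1 / 2 : ℝ) < σ := hσ2
  have h2 := ((riemannZeta_eulerProduct_hasProd (s := 2 * ((σ : ℂ) + t * Complex.I))
    (by simp; linarith)).comp tendsto_primesUpTo_atTop).norm
  filter_upwards [h2.eventually_lt_const hσ] with N hN
  simp only [Function.comp_apply, norm_prod, norm_inv, Finset.prod_inv_distrib] at hN
  have h3 : ∀ p : Nat.Primes, ((p : ℕ) : ℂ) ^ (-(2 * ((σ : ℂ) + t * Complex.I))) =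
      (((p : ℕ) : ℂ) ^ (-((σ : ℂ) + t * Complex.I))) ^ 2 := by
    intro p
    rw [← Complex.cpow_nat_mul]; congr 1; push_cast; ring
  simp only [h3] at hN
  refine inv_le_of_inv_le₀ ?_ hN.le
  refine Finset.prod_pos fun p _ => norm_pos_iff.2 ?_
  have hb := norm_prime_cpow_sq_le p (s := (σ : ℂ) + t * Complex.I) (by simp; linarith)
  rw [show ∀ z : ℂ, 1 - z ^ 2 = (1 + z) * (1 - z) by intro z; ring]
  exact mul_ne_zero (one_add_ne_zero_of_norm_sq_le hb) (one_sub_ne_zero_of_norm_sq_le hb)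

/-- The second moment of the difference in `prod_sub_abelSum`. -/
noncomputable def truncationError (σ : ℝ) (N : ℕ) : ℝ :=
  ∑ S ∈ (primesUpTo N).powerset, ((max (primeProd S) (N + 1) : ℕ) : ℝ) ^ (-(2 * σ))

lemma tendsto_truncationError {σ : ℝ} (hσ : 1 / 2 < σ) :
    Tendsto (truncationError σ) atTop (𝓝 0) := by
  -- The maximum with 1 matters at n = 0, where the power is 0 by convention and would dominate
  -- nothing.
  have hsum : Summable fun n : ℕ => ((max n 1 : ℕ) : ℝ) ^ (-(2 * σ)) := by
    refine (Real.summable_nat_rpow.2 (by linarith : -(2 * σ) < -1)).congr_cofinite ?_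
    rw [Nat.cofinite_eq_atTop]
    filter_upwards [eventually_ge_atTop 1] with n hn
    rw [max_eq_left hn]
  have hle : ∀ N n : ℕ, ((max n (N + 1) : ℕ) : ℝ) ^ (-(2 * σ)) ≤
      ((max n 1 : ℕ) : ℝ) ^ (-(2 * σ)) := fun N n => by
    refine Real.rpow_le_rpow_of_nonpos ?_ ?_ (by linarith)
    · exact_mod_cast (by lia : 0 < max n 1)
    · exact_mod_cast (by lia : max n 1 ≤ max n (N + 1))
  have hN : ∀ N : ℕ, Summable fun n : ℕ => ((max n (N + 1) : ℕ) : ℝ) ^ (-(2 * σ)) := fun N =>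
    Summable.of_nonneg_of_le (fun n => by positivity) (hle N) hsum
  have hlim : Tendsto (fun N : ℕ => ∑' n : ℕ, ((max n (N + 1) : ℕ) : ℝ) ^ (-(2 * σ))) atTop
      (𝓝 (∑' _ : ℕ, (0 : ℝ))) := by
    refine tendsto_tsum_of_dominated_convergence hsum (fun n => ?_)
      (Eventually.of_forall fun N n => ?_)
    · refine (tendsto_rpow_neg_atTop (by linarith : 0 < 2 * σ)).comp
        (tendsto_natCast_atTop_atTop.comp ?_)
      exact tendsto_atTop_mono (fun N => by lia : ∀ N, N ≤ max n (N + 1)) tendsto_id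
    · rw [Real.norm_of_nonneg (by positivity)]; exact hle N n
  rw [tsum_zero] at hlim
  refine squeeze_zero (fun N => Finset.sum_nonneg fun S _ => by positivity) (fun N => ?_) hlim
  calc truncationError σ N
      = ∑ n ∈ (primesUpTo N).powerset.map ⟨primeProd, primeProd_injective⟩,
          ((max n (N + 1) : ℕ) : ℝ) ^ (-(2 * σ)) := by rw [Finset.sum_map]; rfl
    _ ≤ _ := (hN N).sum_le_tsum _ fun n _ => by positivity

/-- The choice of the parameters. -/
lemma exists_parameters : ∃ t : ℝ, ∃ c > 0, ∀ K : ℝ, ∀ ε > 0, ∃ σ : ℝ, ∃ N : ℕ,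
    1 / 2 < σ ∧ σ ≤ 1 ∧
    K ≤ ∑ p ∈ primesUpTo N, ((p : ℕ) : ℝ) ^ (-(2 * σ)) ∧
    K ≤ ∑ p ∈ primesUpTo N, oddLog (((p : ℕ) : ℂ) ^ (-((σ : ℂ) + t * Complex.I))) ^ 2 ∧
    c ≤ ∏ p ∈ primesUpTo N, ‖1 - (((p : ℕ) : ℂ) ^ (-((σ : ℂ) + t * Complex.I))) ^ 2‖ ∧
    truncationError σ N ≤ ε := by
  obtain ⟨t, ht, hW⟩ := exists_not_summable_oddLog_sq
  obtain ⟨c, hc, hprod⟩ := exists_le_prod_norm_one_sub ht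
  refine ⟨t, c, hc, fun K ε hε => ?_⟩
  -- σ is fixed before N, since the truncation error vanishes only as N → ∞ for fixed σ.
  have h1 : ∀ᶠ σ : ℝ in 𝓝 (1 / 2 : ℝ), σ ≤ 1 := eventually_le_nhds (by norm_num)
  obtain ⟨σ, ⟨⟨h1, hV⟩, hW⟩, hprod, hσ⟩ := (((h1.and (eventually_le_sum_rpow K)).and
    (eventually_le_sum_oddLog_sq hW K)).filter_mono nhdsWithin_le_nhds |>.and
      (hprod.and (self_mem_nhdsWithin (a := 1 / 2) (s := Set.Ioi (1 / 2 : ℝ))))).exists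
  obtain ⟨N, hN⟩ := ((hV.and hW).and (hprod.and
    ((tendsto_truncationError hσ).eventually_le_const hε))).exists
  exact ⟨σ, N, hσ, h1, hN.1.1, hN.1.2, hN.2.1, hN.2.2⟩

/-! ### Orthogonality and moments of Rademacher products and sums -/

lemma prod_mul_prod_of_sign {ι : Type*} [DecidableEq ι] {a : ι → ℝ} (ha : ∀ i, a i = 1 ∨ a i = -1)
    (S T : Finset ι) : (∏ i ∈ S, a i) * ∏ i ∈ T, a i = ∏ i ∈ symmDiff S T, a i := by
  have h1 : ∏ i ∈ S ∩ T, a i * a i = 1 :=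
    Finset.prod_eq_one fun i _ => by rcases ha i with h | h <;> simp [h]
  rw [Finset.prod_mul_distrib] at h1
  rw [symmDiff, Finset.sup_eq_union, Finset.prod_union (disjoint_sdiff_sdiff),
    ← Finset.prod_inter_mul_prod_sdiff S T, ← Finset.prod_inter_mul_prod_sdiff T S,
    Finset.inter_comm T S]
  linear_combination (∏ i ∈ S \ T, a i) * (∏ i ∈ T \ S, a i) * h1

lemma sq_sum_prod_eq {Ω : Type*} {X : Nat.Primes → Ω → ℝ}
    (𝒜 : Finset (Finset Nat.Primes)) (c : Finset Nat.Primes → ℝ) (ω : Ω) :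
    (∑ S ∈ 𝒜, (∏ p ∈ S, X p ω) * c S) ^ 2 =
      ∑ S ∈ 𝒜, ∑ T ∈ 𝒜, (c S * c T) * ((∏ p ∈ S, X p ω) * ∏ p ∈ T, X p ω) := by
  rw [sq, Finset.sum_mul_sum]
  exact Finset.sum_congr rfl fun _ _ => Finset.sum_congr rfl fun _ _ => by ring

/-- Integrability travels with the value, so nested applications integrate a polynomial in a
Rademacher sum term by term. -/
lemma integral_add_const_mul {Ω : Type*} [MeasurableSpace Ω] {P : Measure Ω} {f g : Ω → ℝ}
    {a b : ℝ} (hf : Integrable f P ∧ ∫ ω, f ω ∂P = a) (hg : Integrable g P ∧ ∫ ω, g ω ∂P = b)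
    (c : ℝ) : Integrable (fun ω => f ω + c * g ω) P ∧ ∫ ω, f ω + c * g ω ∂P = a + c * b :=
  ⟨hf.1.add (hg.1.const_mul c), by
    rw [integral_add hf.1 (hg.1.const_mul c), integral_const_mul, hf.2, hg.2]⟩

namespace IsRademacherFamily

variable {Ω : Type*} [MeasurableSpace Ω] {P : Measure Ω}
  {X : Nat.Primes → Ω → ℝ}

lemma ae_sign (hX : IsRademacherFamily P X) : ∀ᵐ ω ∂P, ∀ p, X p ω = 1 ∨ X p ω = -1 := by
  rw [ae_all_iff]
  intro p
  have hmeas : MeasurableSet {x : ℝ | x = 1 ∨ x = -1} :=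
    (measurableSet_singleton (1 : ℝ)).union (measurableSet_singleton (-1 : ℝ))
  rw [← ae_map_iff (p := fun x => x = 1 ∨ x = -1) (hX.measurable p).aemeasurable hmeas, hX.law,
    rademacherMeasure, ae_add_measure_iff]
  constructor <;> refine Measure.ae_smul_measure ?_ _ <;> simp [ae_dirac_eq]

lemma integral_eq_zero (hX : IsRademacherFamily P X) (p : Nat.Primes) : ∫ ω, X p ω ∂P = 0 := by
  have h : ∫ ω, X p ω ∂P = ∫ x, x ∂(P.map (X p)) :=
    (integral_map (f := fun x : ℝ => x) (hX.measurable p).aemeasurable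
      aestronglyMeasurable_id).symm
  rw [h, hX.law, rademacherMeasure, integral_add_measure, integral_smul_measure,
    integral_smul_measure, integral_dirac, integral_dirac]
  · simp
  · exact (integrable_dirac (by simp)).smul_measure (by simp)
  · exact (integrable_dirac (by simp)).smul_measure (by simp)

lemma integral_prod_eq_zero (hX : IsRademacherFamily P X) {S : Finset Nat.Primes}
    (hS : S.Nonempty) : ∫ ω, ∏ p ∈ S, X p ω ∂P = 0 := by
  have h := (hX.indep.precomp (g := fun p : S => (p : Nat.Primes))
    Subtype.val_injective).integral_fun_prod_eq_prod_integral
      (fun p => (hX.measurable p).aestronglyMeasurable)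
  simp only [hX.integral_eq_zero] at h
  obtain ⟨p, hp⟩ := hS
  rw [Finset.prod_eq_zero (Finset.mem_univ (⟨p, hp⟩ : S)) rfl] at h
  rw [← h]
  refine integral_congr_ae (Eventually.of_forall fun ω => ?_)
  exact (Finset.prod_coe_sort S fun p => X p ω).symm

lemma measurable_prod (hX : IsRademacherFamily P X) (S : Finset Nat.Primes) :
    Measurable fun ω => ∏ p ∈ S, X p ω :=
  Finset.measurable_fun_prod _ fun p _ => hX.measurable p

lemma measurable_sum (hX : IsRademacherFamily P X) (A : Finset Nat.Primes) (l : Nat.Primes → ℝ) :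
    Measurable fun ω => ∑ p ∈ A, X p ω * l p :=
  Finset.measurable_fun_sum _ fun p _ => (hX.measurable p).mul_const _

lemma integrable_prod [IsProbabilityMeasure P] (hX : IsRademacherFamily P X) (S : Finset Nat.Primes) :
    Integrable (fun ω => ∏ p ∈ S, X p ω) P := by
  refine Integrable.of_bound (hX.measurable_prod S).aestronglyMeasurable 1 ?_
  filter_upwards [hX.ae_sign] with ω hω
  rw [norm_prod]
  refine Finset.prod_le_one (fun _ _ => norm_nonneg _) fun p _ => ?_
  rcases hω p with h | h <;> simp [h]

lemma prod_mul_prod_ae_eq (hX : IsRademacherFamily P X) (S T : Finset Nat.Primes) :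
    (fun ω => (∏ p ∈ S, X p ω) * ∏ p ∈ T, X p ω) =ᵐ[P] fun ω => ∏ p ∈ symmDiff S T, X p ω := by
  filter_upwards [hX.ae_sign] with ω hω
  exact prod_mul_prod_of_sign hω S T

lemma integral_prod_mul_prod [IsProbabilityMeasure P] (hX : IsRademacherFamily P X) (S T : Finset Nat.Primes) :
    ∫ ω, (∏ p ∈ S, X p ω) * ∏ p ∈ T, X p ω ∂P = if S = T then 1 else 0 := by
  rw [integral_congr_ae (hX.prod_mul_prod_ae_eq S T)]
  split_ifs with h
  · subst h
    simp
  · exact hX.integral_prod_eq_zero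
      (Finset.nonempty_iff_ne_empty.2 fun h' => h (symmDiff_eq_bot.1 h'))

lemma integrable_prod_mul_prod [IsProbabilityMeasure P] (hX : IsRademacherFamily P X) (S T : Finset Nat.Primes) :
    Integrable (fun ω => (∏ p ∈ S, X p ω) * ∏ p ∈ T, X p ω) P :=
  (hX.integrable_prod _).congr (hX.prod_mul_prod_ae_eq S T).symm

lemma integrable_sq_sum_prod [IsProbabilityMeasure P] (hX : IsRademacherFamily P X) (𝒜 : Finset (Finset Nat.Primes))
    (c : Finset Nat.Primes → ℝ) :
    Integrable (fun ω => (∑ S ∈ 𝒜, (∏ p ∈ S, X p ω) * c S) ^ 2) P := by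
  simp only [sq_sum_prod_eq]
  exact integrable_finsetSum _ fun S _ => integrable_finsetSum _ fun T _ =>
    (hX.integrable_prod_mul_prod S T).const_mul _

/-- The products of the variables over finite sets of primes are orthonormal. -/
lemma integral_sq_sum_prod [IsProbabilityMeasure P] (hX : IsRademacherFamily P X) (𝒜 : Finset (Finset Nat.Primes))
    (c : Finset Nat.Primes → ℝ) :
    ∫ ω, (∑ S ∈ 𝒜, (∏ p ∈ S, X p ω) * c S) ^ 2 ∂P = ∑ S ∈ 𝒜, c S ^ 2 := by
  simp only [sq_sum_prod_eq]
  rw [integral_finsetSum _ fun S _ => integrable_finsetSum _ fun T _ =>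
    (hX.integrable_prod_mul_prod S T).const_mul _]
  refine Finset.sum_congr rfl fun S hS => ?_
  rw [integral_finsetSum _ fun T _ => (hX.integrable_prod_mul_prod S T).const_mul _]
  simp_rw [integral_const_mul, hX.integral_prod_mul_prod]
  simp [hS, sq]

/-- Chebyshev's inequality for combinations of products of the variables. -/
lemma measure_one_le_norm_sum_prod [IsProbabilityMeasure P] (hX : IsRademacherFamily P X)
    (𝒜 : Finset (Finset Nat.Primes)) (c : Finset Nat.Primes → ℂ) :
    P {ω | 1 ≤ ‖∑ S ∈ 𝒜, ((∏ p ∈ S, X p ω : ℝ) : ℂ) * c S‖} ≤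
      ENNReal.ofReal (∑ S ∈ 𝒜, ‖c S‖ ^ 2) := by
  have hsq : ∀ ω, ‖∑ S ∈ 𝒜, ((∏ p ∈ S, X p ω : ℝ) : ℂ) * c S‖ ^ 2 =
      (∑ S ∈ 𝒜, (∏ p ∈ S, X p ω) * (c S).re) ^ 2 +
        (∑ S ∈ 𝒜, (∏ p ∈ S, X p ω) * (c S).im) ^ 2 := by
    intro ω
    rw [← Complex.normSq_eq_norm_sq, Complex.normSq_apply, Complex.re_sum, Complex.im_sum]
    simp only [Complex.re_ofReal_mul, Complex.im_ofReal_mul]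
    ring
  have h := mul_meas_ge_le_integral_of_nonneg (μ := P)
    (f := fun ω => ‖∑ S ∈ 𝒜, ((∏ p ∈ S, X p ω : ℝ) : ℂ) * c S‖ ^ 2)
    (Eventually.of_forall fun ω => by positivity)
    (by simp only [hsq]
        exact (hX.integrable_sq_sum_prod _ _).add (hX.integrable_sq_sum_prod _ _)) 1
  simp only [hsq] at h
  rw [integral_add (hX.integrable_sq_sum_prod _ _) (hX.integrable_sq_sum_prod _ _),
    hX.integral_sq_sum_prod, hX.integral_sq_sum_prod, ← Finset.sum_add_distrib, one_mul] at h
  simp only [← hsq] at h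
  have h2 : ∑ S ∈ 𝒜, ‖c S‖ ^ 2 = ∑ S ∈ 𝒜, ((c S).re ^ 2 + (c S).im ^ 2) := by
    refine Finset.sum_congr rfl fun S _ => ?_
    rw [← Complex.normSq_eq_norm_sq, Complex.normSq_apply]; ring
  rw [h2, ENNReal.le_ofReal_iff_toReal_le (measure_ne_top _ _)
    (Finset.sum_nonneg fun _ _ => by positivity)]
  refine le_trans (le_of_eq ?_) h
  rw [measureReal_def]
  congr 3
  ext ω
  exact (one_le_sq_iff₀ (norm_nonneg _)).symm

lemma integrable_pow_mul_pow [IsProbabilityMeasure P] (hX : IsRademacherFamily P X)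
    (A : Finset Nat.Primes) (l : Nat.Primes → ℝ) (q : Nat.Primes) (i j : ℕ) :
    Integrable (fun ω => (∑ p ∈ A, X p ω * l p) ^ i * X q ω ^ j) P := by
  refine Integrable.of_bound (((hX.measurable_sum A l).pow_const i).mul
    ((hX.measurable q).pow_const j)).aestronglyMeasurable ((∑ p ∈ A, |l p|) ^ i) ?_
  filter_upwards [hX.ae_sign] with ω hω
  have h1 : ‖X q ω ^ j‖ = 1 := by
    rw [norm_pow]; rcases hω q with h | h <;> simp [h]
  have h2 : ‖∑ p ∈ A, X p ω * l p‖ ≤ ∑ p ∈ A, |l p| := by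
    refine norm_sum_le_of_le _ fun p _ => ?_
    rcases hω p with h | h <;> simp [h]
  rw [norm_mul, h1, mul_one, norm_pow]
  gcongr

lemma integrable_pow [IsProbabilityMeasure P] (hX : IsRademacherFamily P X) (A : Finset Nat.Primes)
    (l : Nat.Primes → ℝ) (i : ℕ) :
    Integrable (fun ω => (∑ p ∈ A, X p ω * l p) ^ i) P := by
  simpa using hX.integrable_pow_mul_pow A l ⟨2, Nat.prime_two⟩ i 0

lemma integral_pow_mul (hX : IsRademacherFamily P X) {A : Finset Nat.Primes}
    (l : Nat.Primes → ℝ) {q : Nat.Primes} (hq : q ∉ A) (i : ℕ) :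
    ∫ ω, (∑ p ∈ A, X p ω * l p) ^ i * X q ω ∂P = 0 := by
  have h := hX.indep.indepFun_finset A {q} (by simpa using hq) hX.measurable
  have h1 : Measurable fun x : A → ℝ => (∑ p : A, x p * l p) ^ i := by fun_prop
  have h2 : Measurable fun x : ({q} : Finset Nat.Primes) → ℝ => x ⟨q, by simp⟩ := by fun_prop
  have h3 := (h.comp h1 h2).integral_fun_mul_eq_mul_integral
    (h1.comp (measurable_pi_lambda (fun ω (p : A) => X p ω)
      fun p => hX.measurable p)).aestronglyMeasurable
    (hX.measurable q).aestronglyMeasurable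
  have h4 : ∫ ω, ((fun x : ({q} : Finset Nat.Primes) → ℝ => x ⟨q, by simp⟩) ∘
      fun a (i : ({q} : Finset Nat.Primes)) => X i a) ω ∂P = 0 := hX.integral_eq_zero q
  rw [h4, mul_zero] at h3
  rw [← h3]
  refine integral_congr_ae (Eventually.of_forall fun ω => ?_)
  simp only [Function.comp_apply]
  rw [Finset.sum_coe_sort A fun p => X p ω * l p]

/-- The first four moments of a Rademacher sum. -/
lemma moments [IsProbabilityMeasure P] (hX : IsRademacherFamily P X) (A : Finset Nat.Primes) (l : Nat.Primes → ℝ) :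
    ∫ ω, (∑ p ∈ A, X p ω * l p) ^ 1 ∂P = 0 ∧
    ∫ ω, (∑ p ∈ A, X p ω * l p) ^ 2 ∂P = ∑ p ∈ A, l p ^ 2 ∧
    ∫ ω, (∑ p ∈ A, X p ω * l p) ^ 3 ∂P = 0 ∧
    ∫ ω, (∑ p ∈ A, X p ω * l p) ^ 4 ∂P ≤ 3 * (∑ p ∈ A, l p ^ 2) ^ 2 := by
  induction A using Finset.induction_on with
  | empty => simp
  | insert q A hq ih =>
    obtain ⟨m1, m2, m3, m4⟩ := ih
    have hi := hX.integrable_pow A l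
    have hj : ∀ i, Integrable (fun ω => (∑ p ∈ A, X p ω * l p) ^ i * X q ω) P := fun i => by
      simpa using hX.integrable_pow_mul_pow A l q i 1
    have hz := fun i => hX.integral_pow_mul l hq i
    let Y : Ω → ℝ := fun ω => ∑ p ∈ A, X p ω * l p
    have hexp : ∀ ω, ∑ p ∈ insert q A, X p ω * l p = X q ω * l q + Y ω := fun ω =>
      Finset.sum_insert hq
    have I : ∀ {k : ℕ} {m : ℝ}, ∫ ω, Y ω ^ k ∂P = m →
        Integrable (fun ω => Y ω ^ k) P ∧ ∫ ω, Y ω ^ k ∂P = m := fun h => ⟨hi _, h⟩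
    have J : ∀ k : ℕ, Integrable (fun ω => Y ω ^ k * X q ω) P ∧
        ∫ ω, Y ω ^ k * X q ω ∂P = 0 := fun k => ⟨hj k, hz k⟩
    have I0 := I (k := 0) (m := 1) (by simp)
    have e1 : (fun ω => (∑ p ∈ insert q A, X p ω * l p) ^ 1) =ᵐ[P]
        fun ω => Y ω ^ 1 + l q * (Y ω ^ 0 * X q ω) :=
      Eventually.of_forall fun ω => by simp only [hexp]; ring
    have e2 : (fun ω => (∑ p ∈ insert q A, X p ω * l p) ^ 2) =ᵐ[P]
        fun ω => Y ω ^ 2 + 2 * l q * (Y ω ^ 1 * X q ω) + l q ^ 2 * Y ω ^ 0 := by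
      filter_upwards [hX.ae_sign] with ω hω
      rcases hω q with h | h <;> simp only [hexp, h] <;> ring
    have e3 : (fun ω => (∑ p ∈ insert q A, X p ω * l p) ^ 3) =ᵐ[P]
        fun ω => Y ω ^ 3 + 3 * l q * (Y ω ^ 2 * X q ω) + 3 * l q ^ 2 * Y ω ^ 1 +
          l q ^ 3 * (Y ω ^ 0 * X q ω) := by
      filter_upwards [hX.ae_sign] with ω hω
      rcases hω q with h | h <;> simp only [hexp, h] <;> ring
    have e4 : (fun ω => (∑ p ∈ insert q A, X p ω * l p) ^ 4) =ᵐ[P]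
        fun ω => Y ω ^ 4 + 4 * l q * (Y ω ^ 3 * X q ω) + 6 * l q ^ 2 * Y ω ^ 2 +
          4 * l q ^ 3 * (Y ω ^ 1 * X q ω) + l q ^ 4 * Y ω ^ 0 := by
      filter_upwards [hX.ae_sign] with ω hω
      rcases hω q with h | h <;> simp only [hexp, h] <;> ring
    rw [integral_congr_ae e1, integral_congr_ae e2, integral_congr_ae e3, integral_congr_ae e4,
      Finset.sum_insert hq, (integral_add_const_mul (I m1) (J 0) _).2,
      (integral_add_const_mul (integral_add_const_mul (I m2) (J 1) _) I0 _).2,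
      (integral_add_const_mul (integral_add_const_mul (integral_add_const_mul (I m3) (J 2) _)
        (I m1) _) (J 0) _).2,
      (integral_add_const_mul (integral_add_const_mul (integral_add_const_mul
        (integral_add_const_mul (I (k := 4) rfl) (J 3) _) (I m2) _) (J 1) _) I0 _).2]
    refine ⟨by ring, by ring, by ring, ?_⟩
    have m4' : ∫ ω, Y ω ^ 4 ∂P ≤ 3 * (∑ p ∈ A, l p ^ 2) ^ 2 := m4
    -- The new fourth moment adds 6 l² ∑ l p² + l⁴, while the bound grows by 6 l² ∑ l p² + 3 l⁴.
    nlinarith [sq_nonneg (l q ^ 2)]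

lemma measure_le_sum [IsProbabilityMeasure P] (hX : IsRademacherFamily P X) (A : Finset Nat.Primes)
    (l : Nat.Primes → ℝ) {b : ℝ} (hb : 0 < b) :
    P {ω | b ≤ ∑ p ∈ A, X p ω * l p} ≤ ENNReal.ofReal ((∑ p ∈ A, l p ^ 2) / b ^ 2) := by
  have h := mul_meas_ge_le_integral_of_nonneg (μ := P)
    (f := fun ω => (∑ p ∈ A, X p ω * l p) ^ 2)
    (Eventually.of_forall fun ω => by positivity) (hX.integrable_pow A l 2) (b ^ 2)
  rw [(hX.moments A l).2.1, mul_comm, ← le_div_iff₀ (by positivity)] at h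
  rw [ENNReal.le_ofReal_iff_toReal_le (measure_ne_top _ _)
    (div_nonneg (Finset.sum_nonneg fun _ _ => by positivity) (by positivity))]
  refine le_trans (measureReal_mono fun ω hω => ?_) h
  exact pow_le_pow_left₀ hb.le hω 2

/-- A Rademacher sum is large and positive with probability bounded below. -/
lemma le_measure_le_sum [IsProbabilityMeasure P] (hX : IsRademacherFamily P X) (A : Finset Nat.Primes)
    (l : Nat.Primes → ℝ) {v : ℝ} (hv : 0 < v) (hvl : v ^ 2 = ∑ p ∈ A, l p ^ 2) :
    1 / 25 ≤ P.real {ω | v / 10 ≤ ∑ p ∈ A, X p ω * l p} := by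
  obtain ⟨m1, m2, m3, m4⟩ := hX.moments A l
  have hi := hX.integrable_pow A l
  have hmeas := hX.measurable_sum A l
  rw [← hvl] at m2 m4
  let Y : Ω → ℝ := fun ω => ∑ p ∈ A, X p ω * l p
  have I : ∀ {k : ℕ} {m : ℝ}, ∫ ω, Y ω ^ k ∂P = m →
      Integrable (fun ω => Y ω ^ k) P ∧ ∫ ω, Y ω ^ k ∂P = m := fun h => ⟨hi _, h⟩
  have hE : MeasurableSet {ω | v / 10 ≤ Y ω} := measurableSet_le measurable_const hmeas
  -- The quartic (Y - v/10)(3v - Y)(Y + v)² is positive only for v/10 < Y < 3v (up to Y = -v it is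
  -- never positive below), where it is at most 34v⁴. The odd moments vanish, so its mean is at
  -- least (4.9 - 3 - 0.3)v⁴ = 1.6v⁴, and 1.6/34 > 1/25.
  have hpt : ∀ ω, Y ω ^ 1 + (5 / 2 * v ^ 3 - 1) * Y ω ^ 1 + 49 / 10 * v ^ 2 * Y ω ^ 2 +
      11 / 10 * v * Y ω ^ 3 + (-1) * Y ω ^ 4 + -(3 / 10 * v ^ 4) * Y ω ^ 0 ≤
      {ω | v / 10 ≤ Y ω}.indicator (fun _ => 34 * v ^ 4) ω := by
    intro ω
    have hfac : Y ω ^ 1 + (5 / 2 * v ^ 3 - 1) * Y ω ^ 1 + 49 / 10 * v ^ 2 * Y ω ^ 2 +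
      11 / 10 * v * Y ω ^ 3 + (-1) * Y ω ^ 4 + -(3 / 10 * v ^ 4) * Y ω ^ 0 =
        (Y ω - v / 10) * (3 * v - Y ω) * (Y ω + v) ^ 2 := by ring
    rw [hfac]
    by_cases h : v / 10 ≤ Y ω
    · rw [Set.indicator_of_mem (by exact h)]
      by_cases h3 : Y ω ≤ 3 * v
      · have h5 : (Y ω - v / 10) * (3 * v - Y ω) ≤ 17 / 8 * v ^ 2 := by
          nlinarith [sq_nonneg (Y ω - 31 / 20 * v), sq_nonneg v]
        have h6 : (Y ω + v) ^ 2 ≤ 16 * v ^ 2 := by nlinarith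
        calc _ ≤ (17 / 8 * v ^ 2) * (16 * v ^ 2) := by gcongr
          _ = 34 * v ^ 4 := by ring
      · refine le_trans (mul_nonpos_of_nonpos_of_nonneg
          (mul_nonpos_of_nonneg_of_nonpos ?_ ?_) (sq_nonneg _)) (by positivity) <;> linarith
    · rw [Set.indicator_of_notMem (by exact h)]
      rw [not_le] at h
      refine mul_nonpos_of_nonpos_of_nonneg
          (mul_nonpos_of_nonpos_of_nonneg ?_ ?_) (sq_nonneg _) <;> linarith
  have hint := integral_add_const_mul (integral_add_const_mul (integral_add_const_mul
    (integral_add_const_mul (integral_add_const_mul (I m1) (I m1) (5 / 2 * v ^ 3 - 1))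
      (I m2) (49 / 10 * v ^ 2)) (I m3) (11 / 10 * v)) (I (k := 4) rfl) (-1))
      (I (k := 0) (m := 1) (by simp)) (-(3 / 10 * v ^ 4))
  have h := integral_mono hint.1 ((integrable_const (34 * v ^ 4)).indicator hE) hpt
  rw [integral_indicator_const _ hE, smul_eq_mul, hint.2] at h
  have hv4 : 0 < v ^ 4 := by positivity
  have m4' : ∫ ω, Y ω ^ 4 ∂P ≤ 3 * (v ^ 2) ^ 2 := m4
  have h7 : 16 / 10 * v ^ 4 ≤ P.real {ω | v / 10 ≤ Y ω} * (34 * v ^ 4) := by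
    refine le_trans ?_ h
    nlinarith
  change 1 / 25 ≤ P.real {ω | v / 10 ≤ Y ω}
  by_contra! hlt
  nlinarith

/-! ### Zero-one law and almost sure unboundedness -/

/-- Unboundedness of a sequence of weighted sums with bounded weights is a tail event. -/
lemma measure_unbounded_zero_or_one (hX : IsRademacherFamily P X) (A : ℕ → Finset Nat.Primes)
    (l : ℕ → Nat.Primes → ℝ) {B : ℝ} (hB : ∀ k p, |l k p| ≤ B) :
    P {ω | ∀ C : ℕ, ∃ k, (C : ℝ) ≤ ∑ p ∈ A k, X p ω * l k p} = 0 ∨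
      P {ω | ∀ C : ℕ, ∃ k, (C : ℝ) ≤ ∑ p ∈ A k, X p ω * l k p} = 1 := by
  classical
  set s : Nat.Primes → MeasurableSpace Ω := fun p => MeasurableSpace.comap (X p) inferInstance
  have hs : ∀ p, s p ≤ ‹MeasurableSpace Ω› := fun p => (hX.measurable p).comap_le
  refine measure_zero_or_one_of_measurableSet_limsup (f := cofinite) (p := Set.Finite)
    (ns := fun T : Finset Nat.Primes => (T : Set Nat.Primes)) hs hX.indep
    (fun t ht => ht.compl_mem_cofinite) (directed_of_isDirected_le fun _ _ h => by simpa using h)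
    (fun T => T.finite_toSet) (fun p => ⟨{p}, by simp⟩) ?_
  rw [(hasBasis_cofinite (α := Nat.Primes)).limsup_eq_iInf_iSup]
  simp only [MeasurableSpace.measurableSet_iInf]
  intro T hT
  -- Deleting the primes of a finite set moves all the sums by an amount bounded uniformly in k,
  -- thanks to the bound on the weights.
  have hset : {ω | ∀ C : ℕ, ∃ k, (C : ℝ) ≤ ∑ p ∈ A k, X p ω * l k p} =
      {ω | ∀ C : ℕ, ∃ k, (C : ℝ) ≤ ∑ p ∈ A k \ hT.toFinset, X p ω * l k p} := by
    ext ω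
    have hdiff : ∀ k, |∑ p ∈ A k, X p ω * l k p - ∑ p ∈ A k \ hT.toFinset, X p ω * l k p| ≤
        ∑ p ∈ hT.toFinset, |X p ω| * B := by
      intro k
      rw [← Finset.sum_inter_add_sum_sdiff (A k) hT.toFinset, add_sub_cancel_right]
      refine (Finset.abs_sum_le_sum_abs _ _).trans ?_
      have hB0 : 0 ≤ B := (abs_nonneg _).trans (hB 0 ⟨2, Nat.prime_two⟩)
      calc _ ≤ ∑ p ∈ A k ∩ hT.toFinset, |X p ω| * B := by
            refine Finset.sum_le_sum fun p _ => ?_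
            rw [abs_mul]
            gcongr
            exact hB k p
        _ ≤ _ := Finset.sum_le_sum_of_subset_of_nonneg Finset.inter_subset_right
            fun _ _ _ => by positivity
    obtain ⟨D, hD⟩ := exists_nat_ge (∑ p ∈ hT.toFinset, |X p ω| * B)
    constructor
    · intro h C
      obtain ⟨k, hk⟩ := h (C + D)
      refine ⟨k, ?_⟩
      have := abs_le.1 (hdiff k)
      push_cast at hk
      linarith
    · intro h C
      obtain ⟨k, hk⟩ := h (C + D)
      refine ⟨k, ?_⟩
      have := abs_le.1 (hdiff k)
      push_cast at hk
      linarith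
  rw [hset]
  simp only [Set.ofPred_forall, Set.ofPred_exists]
  refine MeasurableSet.iInter fun C => MeasurableSet.iUnion fun k => ?_
  refine measurableSet_le measurable_const (Finset.measurable_fun_sum _ fun p hp => ?_)
  refine Measurable.mul_const ?_ _
  have hpT : p ∈ Tᶜ := by simpa using (Finset.mem_sdiff.1 hp).2
  exact (comap_measurable (X p)).mono (le_iSup₂_of_le p hpT le_rfl) le_rfl

/-- Each event {sum ≥ k} has probability at least 1/25, hence so does their limsup; the zero-one law
raises this to 1. No independence between different k is needed. -/
lemma ae_unbounded [IsProbabilityMeasure P] (hX : IsRademacherFamily P X) (A : ℕ → Finset Nat.Primes)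
    (l : ℕ → Nat.Primes → ℝ) {B : ℝ} (hB : ∀ k p, |l k p| ≤ B)
    (hl : ∀ k : ℕ, (10 * (k + 1) : ℝ) ^ 2 ≤ ∑ p ∈ A k, l k p ^ 2) :
    ∀ᵐ ω ∂P, ∀ C : ℕ, ∃ k, (C : ℝ) ≤ ∑ p ∈ A k, X p ω * l k p := by
  set G : ℕ → Set Ω := fun k => {ω | (k : ℝ) ≤ ∑ p ∈ A k, X p ω * l k p} with hG
  have hGm : ∀ k, MeasurableSet (G k) := fun k =>
    measurableSet_le measurable_const (hX.measurable_sum _ _)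
  have hG1 : ∀ k, ENNReal.ofReal (1 / 25) ≤ P (G k) := fun k => by
    have hpos : 0 < ∑ p ∈ A k, l k p ^ 2 := lt_of_lt_of_le (by positivity) (hl k)
    have h := hX.le_measure_le_sum (A k) (l k) (Real.sqrt_pos.2 hpos) (Real.sq_sqrt hpos.le)
    refine (ENNReal.ofReal_le_iff_le_toReal (measure_ne_top _ _)).2
      (h.trans (measureReal_mono fun ω hω => ?_))
    have h1 : (10 * (k + 1) : ℝ) ≤ √(∑ p ∈ A k, l k p ^ 2) := Real.le_sqrt_of_sq_le (hl k)
    have h2 : √(∑ p ∈ A k, l k p ^ 2) / 10 ≤ ∑ p ∈ A k, X p ω * l k p := hω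
    change (k : ℝ) ≤ ∑ p ∈ A k, X p ω * l k p
    linarith
  have hlim := tendsto_measure_iInter_atTop (μ := P) (s := fun K : ℕ => ⋃ k ≥ K, G k)
    (fun K => (MeasurableSet.iUnion fun k => MeasurableSet.iUnion fun _ =>
      hGm k).nullMeasurableSet)
    (fun K L h => Set.biUnion_mono (fun k hk => le_trans h hk) fun _ _ => le_rfl)
    ⟨0, measure_ne_top _ _⟩
  have hge : ENNReal.ofReal (1 / 25) ≤ P (⋂ K : ℕ, ⋃ k ≥ K, G k) :=
    ge_of_tendsto' hlim fun K => (hG1 K).trans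
      (measure_mono (Set.subset_biUnion_of_mem (u := G) (show K ∈ {k | k ≥ K} from le_refl K)))
  have hsub : (⋂ K : ℕ, ⋃ k ≥ K, G k) ⊆
      {ω | ∀ C : ℕ, ∃ k, (C : ℝ) ≤ ∑ p ∈ A k, X p ω * l k p} := by
    intro ω hω C
    obtain ⟨k, hk, hk'⟩ := Set.mem_iUnion₂.1 (Set.mem_iInter.1 hω C)
    refine ⟨k, le_trans ?_ hk'⟩
    exact_mod_cast hk
  have hmeas : MeasurableSet {ω | ∀ C : ℕ, ∃ k, (C : ℝ) ≤ ∑ p ∈ A k, X p ω * l k p} := by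
    simp only [Set.ofPred_forall, Set.ofPred_exists]
    exact MeasurableSet.iInter fun C => MeasurableSet.iUnion fun k =>
      measurableSet_le measurable_const (hX.measurable_sum _ _)
  rcases hX.measure_unbounded_zero_or_one A l hB with h | h
  · have := (hge.trans (measure_mono hsub)).trans_eq h
    norm_num at this
  · exact (prob_compl_eq_zero_iff hmeas).2 h

end IsRademacherFamily

/-! ### Exceptional events and conclusion -/

lemma ae_eventually_notMem_of_le_geometric {Ω : Type*} [MeasurableSpace Ω] {P : Measure Ω}
    {E : ℕ → Set Ω} (hE : ∀ k, P (E k) ≤ ENNReal.ofReal ((1 / 2) ^ k)) :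
    ∀ᵐ ω ∂P, ∀ᶠ k in atTop, ω ∉ E k :=
  ae_eventually_notMem (ne_top_of_le_ne_top
    (summable_geometric_of_lt_one (by norm_num) (by norm_num)).tsum_ofReal_ne_top
    (ENNReal.tsum_le_tsum hE))

/-- By 1 - x ≤ e^(-x) the drift contributes at most e^(-V/2), which absorbs a random factor up to
e^(V/2). -/
lemma norm_prod_one_add_le_one {a : Nat.Primes → ℝ} (ha : ∀ p, a p = 1 ∨ a p = -1)
    {σ : ℝ} (hσ : 1 / 2 < σ) (A : Finset Nat.Primes)
    (h : ∑ p ∈ A, a p * oddLog (((p : ℕ) : ℂ) ^ (-(σ : ℂ))) ≤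
      (∑ p ∈ A, ((p : ℕ) : ℝ) ^ (-(2 * σ))) / 2) :
    ‖∏ p ∈ A, (1 + (a p : ℂ) * ((p : ℕ) : ℂ) ^ (-(σ : ℂ)))‖ ≤ 1 := by
  rw [prod_norm_one_add_mul A ha fun p => norm_prime_cpow_sq_le p (by simpa using hσ.le)]
  have h1 : ∏ p ∈ A, ‖1 - (((p : ℕ) : ℂ) ^ (-(σ : ℂ))) ^ 2‖ ≤
      Real.exp (-∑ p ∈ A, ((p : ℕ) : ℝ) ^ (-(2 * σ))) := by
    rw [← Finset.sum_neg_distrib, Real.exp_sum]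
    refine Finset.prod_le_prod (fun _ _ => norm_nonneg _) fun p _ => ?_
    have hz : (((p : ℕ) : ℂ) ^ (-(σ : ℂ))) ^ 2 = ((((p : ℕ) : ℝ) ^ (-(2 * σ)) : ℝ) : ℂ) := by
      rw [Complex.ofReal_cpow (by positivity), ← Complex.cpow_nat_mul]
      congr 1; push_cast; ring
    have hle : ((p : ℕ) : ℝ) ^ (-(2 * σ)) ≤ 1 / 2 := by
      have := norm_prime_cpow_sq_le p (s := (σ : ℂ)) (by simpa using hσ.le)
      rwa [norm_prime_cpow_sq, Complex.ofReal_re] at this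
    rw [hz, ← Complex.ofReal_one, ← Complex.ofReal_sub, Complex.norm_real,
      Real.norm_of_nonneg (by linarith)]
    linarith [Real.add_one_le_exp (-((p : ℕ) : ℝ) ^ (-(2 * σ)))]
  set V := ∑ p ∈ A, ((p : ℕ) : ℝ) ^ (-(2 * σ))
  calc _ ≤ √(Real.exp (-V)) * Real.exp (V / 2) := by gcongr
    _ = 1 := by
      rw [← Real.exp_half, ← Real.exp_add]; simp; ring

lemma IsRademacherFamily.measure_half_le_sum_oddLog {Ω : Type*} [MeasurableSpace Ω]
    {P : Measure Ω} [IsProbabilityMeasure P] {X : Nat.Primes → Ω → ℝ}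
    (hX : IsRademacherFamily P X) {σ δ : ℝ} (hσ : 1 / 2 < σ) (hδ : 0 < δ) (A : Finset Nat.Primes)
    (hV : 36 / δ ≤ ∑ p ∈ A, ((p : ℕ) : ℝ) ^ (-(2 * σ))) :
    P {ω | (∑ p ∈ A, ((p : ℕ) : ℝ) ^ (-(2 * σ))) / 2 ≤
      ∑ p ∈ A, X p ω * oddLog (((p : ℕ) : ℂ) ^ (-(σ : ℂ)))} ≤ ENNReal.ofReal δ := by
  set V := ∑ p ∈ A, ((p : ℕ) : ℝ) ^ (-(2 * σ)) with hVdef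
  have hV0 : 0 < V := lt_of_lt_of_le (by positivity) hV
  -- The variance is at most 9V and the threshold is V/2, so Chebyshev gives 36/V ≤ δ.
  refine (hX.measure_le_sum A _ (half_pos hV0)).trans (ENNReal.ofReal_le_ofReal ?_)
  have h1 : ∑ p ∈ A, oddLog (((p : ℕ) : ℂ) ^ (-(σ : ℂ))) ^ 2 ≤ 9 * V := by
    rw [hVdef, Finset.mul_sum]
    refine Finset.sum_le_sum fun p _ => ?_
    have h2 := abs_oddLog_le (norm_prime_cpow_sq_le p (s := (σ : ℂ)) (by simpa using hσ.le))
    have h3 := norm_prime_cpow_sq p (σ : ℂ)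
    rw [Complex.ofReal_re] at h3
    rw [← h3]
    calc _ ≤ (3 * ‖((p : ℕ) : ℂ) ^ (-(σ : ℂ))‖) ^ 2 := sq_le_sq' (abs_le.1 h2).1 (abs_le.1 h2).2
      _ = _ := by ring
  rw [div_le_iff₀ hδ] at hV
  rw [div_le_iff₀ (by positivity)]
  nlinarith

lemma IsRademacherFamily.measure_one_le_norm_prod_sub_abelSum {Ω : Type*} [MeasurableSpace Ω]
    {P : Measure Ω} [IsProbabilityMeasure P] {X : Nat.Primes → Ω → ℝ}
    (hX : IsRademacherFamily P X) (N : ℕ) (s : ℂ) :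
    P {ω | 1 ≤ ‖∏ p ∈ primesUpTo N, (1 + (X p ω : ℂ) * ((p : ℕ) : ℂ) ^ (-s)) -
      abelSum (fun n => randomMultiplicative X n ω) N s‖} ≤
      ENNReal.ofReal (truncationError s.re N) := by
  have h := hX.measure_one_le_norm_sum_prod (primesUpTo N).powerset
    fun S => ((max (primeProd S) (N + 1) : ℕ) : ℂ) ^ (-s)
  have h2 : ∑ S ∈ (primesUpTo N).powerset, ‖((max (primeProd S) (N + 1) : ℕ) : ℂ) ^ (-s)‖ ^ 2 =
      truncationError s.re N := by
    refine Finset.sum_congr rfl fun S _ => ?_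
    rw [Complex.norm_natCast_cpow_of_pos (by lia), Complex.neg_re, ← Real.rpow_natCast (_ ^ _),
      ← Real.rpow_mul (by positivity)]
    congr 1; push_cast; ring
  rw [h2] at h
  refine le_trans (le_of_eq (congrArg P ?_)) h
  ext ω
  exact iff_of_eq (congrArg (fun w : ℂ => 1 ≤ ‖w‖) (prod_sub_abelSum (fun p => X p ω) N s))

/-- If the partial sums are eventually of constant sign, then boundedness of the Euler product on
the real axis entails boundedness of the odd logarithmic sums off the real axis. -/
lemma exists_sum_oddLog_le {a : Nat.Primes → ℝ} (ha : ∀ p, a p = 1 ∨ a p = -1) {n₀ : ℕ}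
    (hsign : (∀ n : ℕ, n ≥ n₀ → 0 ≤ partialSum (squarefreeExtension a) n) ∨
      (∀ n : ℕ, n ≥ n₀ → partialSum (squarefreeExtension a) n ≤ 0)) (t : ℝ) {c : ℝ} (hc : 0 < c) :
    ∃ R : ℝ, ∀ (σ : ℝ) (N : ℕ), 1 / 2 < σ → σ ≤ 1 →
      c ≤ ∏ p ∈ primesUpTo N, ‖1 - (((p : ℕ) : ℂ) ^ (-((σ : ℂ) + t * Complex.I))) ^ 2‖ →
      ‖∏ p ∈ primesUpTo N, (1 + (a p : ℂ) * ((p : ℕ) : ℂ) ^ (-(σ : ℂ)))‖ ≤ 1 →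
      ‖∏ p ∈ primesUpTo N, (1 + (a p : ℂ) * ((p : ℕ) : ℂ) ^ (-(σ : ℂ))) -
        abelSum (squarefreeExtension a) N σ‖ ≤ 1 →
      ‖∏ p ∈ primesUpTo N, (1 + (a p : ℂ) * ((p : ℕ) : ℂ) ^ (-((σ : ℂ) + t * Complex.I))) -
        abelSum (squarefreeExtension a) N ((σ : ℂ) + t * Complex.I)‖ ≤ 1 →
      ∑ p ∈ primesUpTo N, a p * oddLog (((p : ℕ) : ℂ) ^ (-((σ : ℂ) + t * Complex.I))) ≤ R := by
  set B := 2 * ∑ n ∈ Finset.range n₀, |partialSum (squarefreeExtension a) n| with hB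
  have hB0 : 0 ≤ B := by positivity
  -- The Abel sum at σ has norm at most 1 + 1 = 2, |s|/σ ≤ 2(1 + |t|), and truncation at s costs 1
  -- more; √c is the lower bound for the drift factor.
  refine ⟨(1 + 2 * (1 + |t|) * (2 + B)) / √c, fun σ N hσ hσ1 hprod h1 h2 h3 => ?_⟩
  set s : ℂ := (σ : ℂ) + t * Complex.I with hs
  have hre : s.re = σ := by simp [hs]
  have h4 : ‖abelSum (squarefreeExtension a) N σ‖ ≤ 2 := by
    have := norm_sub_norm_le (abelSum (squarefreeExtension a) N σ)
      (∏ p ∈ primesUpTo N, (1 + (a p : ℂ) * ((p : ℕ) : ℂ) ^ (-(σ : ℂ))))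
    rw [norm_sub_rev] at this
    linarith
  have h5 := norm_abelSum_le hsign N (s := s) (by linarith)
  rw [hre] at h5
  have hsn : ‖s‖ / σ ≤ 2 * (1 + |t|) := by
    have h6 : ‖s‖ ≤ 1 + |t| := by
      refine (norm_add_le _ _).trans (add_le_add ?_ ?_)
      · rw [Complex.norm_real, Real.norm_of_nonneg (by linarith)]; exact hσ1
      · simp
    rw [div_le_iff₀ (by linarith)]
    nlinarith [abs_nonneg t]
  have h7 : ‖abelSum (squarefreeExtension a) N s‖ ≤ 2 * (1 + |t|) * (2 + B) :=
    h5.trans (by gcongr)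
  have h8 : ‖∏ p ∈ primesUpTo N, (1 + (a p : ℂ) * ((p : ℕ) : ℂ) ^ (-s))‖ ≤
      1 + 2 * (1 + |t|) * (2 + B) := by
    have := norm_sub_norm_le (∏ p ∈ primesUpTo N, (1 + (a p : ℂ) * ((p : ℕ) : ℂ) ^ (-s)))
      (abelSum (squarefreeExtension a) N s)
    linarith
  rw [prod_norm_one_add_mul _ ha fun p => norm_prime_cpow_sq_le p (by linarith)] at h8
  set x := ∑ p ∈ primesUpTo N, a p * oddLog (((p : ℕ) : ℂ) ^ (-s))
  have h9 : √c * Real.exp x ≤ 1 + 2 * (1 + |t|) * (2 + B) := le_trans (by gcongr) h8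
  rw [le_div_iff₀ (Real.sqrt_pos.2 hc)]
  have h10 := Real.add_one_le_exp x
  nlinarith [Real.sqrt_pos.2 hc]

/-- Finitely many initial terms cannot account for unboundedness, so large values occur beyond every
index, in particular where the exceptional events have ceased. -/
lemma not_eventually_le_of_unbounded {x : ℕ → ℝ} (hx : ∀ C : ℕ, ∃ k, (C : ℝ) ≤ x k) (R : ℝ) :
    ¬ ∀ᶠ k in atTop, x k ≤ R := by
  intro h
  have hb : BddAbove (Set.range x) :=
    (isBoundedUnder_of_eventually_le h).bddAbove_range
  obtain ⟨b, hb⟩ := hb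
  obtain ⟨C, hC⟩ := exists_nat_gt b
  obtain ⟨k, hk⟩ := hx C
  linarith [hb ⟨k, rfl⟩]

theorem theorem1 {Ω : Type*} [MeasurableSpace Ω] (P : Measure Ω) [IsProbabilityMeasure P]
    (X : Nat.Primes → Ω → ℝ) (hX : IsRademacherFamily P X) :
    ∀ᵐ ω ∂P, ChangesSignInfinitelyOften
      (partialSum (fun n => randomMultiplicative X n ω)) := by
  obtain ⟨t, c, hc, hpar⟩ := exists_parameters
  -- The first summand serves Chebyshev with δ = 2^(-k), the second the variance growth required by
  -- `ae_unbounded`.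
  choose σ N hσ hσ1 hV hW hprod herr using fun k : ℕ =>
    hpar (36 / (1 / 2) ^ k + (10 * (k + 1)) ^ 2) ((1 / 2) ^ k) (by positivity)
  have hunb := hX.ae_unbounded (fun k => primesUpTo (N k))
    (fun k p => oddLog (((p : ℕ) : ℂ) ^ (-((σ k : ℂ) + t * Complex.I)))) (B := 3)
    (fun k p => abs_oddLog_prime_cpow_le p (by simpa using (hσ k).le))
    (fun k => le_trans (by simp) (hW k))
  have hE1 := ae_eventually_notMem_of_le_geometric fun k =>
    hX.measure_half_le_sum_oddLog (hσ k) (δ := (1 / 2) ^ k) (by positivity) (primesUpTo (N k))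
      (le_trans (le_add_of_nonneg_right (by positivity)) (hV k))
  have hE2 := ae_eventually_notMem_of_le_geometric fun k =>
    (hX.measure_one_le_norm_prod_sub_abelSum (N k) (σ k)).trans
      (ENNReal.ofReal_le_ofReal (by simpa using herr k))
  have hE3 := ae_eventually_notMem_of_le_geometric fun k =>
    (hX.measure_one_le_norm_prod_sub_abelSum (N k) ((σ k : ℂ) + t * Complex.I)).trans
      (ENNReal.ofReal_le_ofReal (by simpa using herr k))
  filter_upwards [hX.ae_sign, hunb, hE1, hE2, hE3] with ω hsgn hu h1 h2 h3
  have key : ∀ n₀ : ℕ, ¬ ((∀ n : ℕ, n ≥ n₀ →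
      0 ≤ partialSum (squarefreeExtension fun p => X p ω) n) ∨
      (∀ n : ℕ, n ≥ n₀ → partialSum (squarefreeExtension fun p => X p ω) n ≤ 0)) := by
    intro n₀ hn₀
    obtain ⟨R, hR⟩ := exists_sum_oddLog_le hsgn hn₀ t hc
    refine not_eventually_le_of_unbounded hu R ?_
    filter_upwards [h1, h2, h3] with k h1 h2 h3
    exact hR (σ k) (N k) (hσ k) (hσ1 k) (hprod k)
      (norm_prod_one_add_le_one hsgn (hσ k) _ (not_le.1 h1).le) (not_le.1 h2).le (not_le.1 h3).le
  constructor
  · intro h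
    obtain ⟨n₀, hn₀⟩ := eventually_atTop.1 (tendsto_natCast_atTop_atTop.eventually h)
    exact key n₀ (Or.inl hn₀)
  · intro h
    obtain ⟨n₀, hn₀⟩ := eventually_atTop.1 (tendsto_natCast_atTop_atTop.eventually h)
    exact key n₀ (Or.inr hn₀)
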